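/- Let $K$ be an infinite field and let $\Lambda$ be a finite dimensional hereditary $K$-algebra. Let $S_1,\dots,S_n$ be representatives of the isomorphism classes of simple right $\Lambda$-modules, let $P_i$ be the projective cover of $S_i$, and for $\gamma\in\mathbb N^n$ put $P(\gamma)=\bigoplus_i P_i^{\gamma_i}$. The dimension vector of a finite dimensional module $M$ is $\underline{\dim}\,M=(\dim_{F_i}\operatorname{Hom}_\Lambda(P_i,M))_i$, where $F_i=\operatorname{End}_\Lambda(P_i)$. Let $\mathrm{Pres}(\Lambda)$ be the category whose objects (presentations) are the chain complexes $X_1\to X_0$ of finitely generated projective right $\Lambda$-modules in degrees $1$ and $0$, and whose morphisms are the homotopy classes of chain maps of degree $0$; for two presentations let $\operatorname{Ext}^1_{\mathrm{Pres}(\Lambda)}(X,Y)$ be the space of homotopy classes of chain maps $X\to Y[1]$. Let $\gamma_0,\gamma_1\in\mathbb N^n$, and let $P(\gamma_*)=(p:P(\gamma_1)\to P(\gamma_0))$ be a presentation with dimension vector $\underline{\dim}\,P(\gamma_0)-\underline{\dim}\,P(\gamma_1)=\alpha\in\mathbb Z^n$ such that $\operatorname{Ext}^1_{\mathrm{Pres}(\Lambda)}(P(\gamma_*),P(\gamma_*))=0$.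 Then the set of all $f\in \mathrm{Pres}_\Lambda(\gamma_1,\gamma_0)=\operatorname{Hom}_\Lambda(P(\gamma_1),P(\gamma_0))$ such that the presentation $f:P(\gamma_1)\to P(\gamma_0)$ is isomorphic to $P(\gamma_*)$ in $\mathrm{Pres}(\Lambda)$ is open and dense in the Zariski topology on (the $K$-points of) the $K$-affine space $\mathrm{Pres}_\Lambda(\gamma_1,\gamma_0)$. -/

import Mathlib

open CategoryTheory

universe u v

/-- The ring `Λ` is right hereditary: every right ideal is a projective right module. (For a
finite dimensional algebra over a field this is the same as left hereditary.) -/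
def IsHereditary (Λ : Type v) [Ring Λ] : Prop :=
  ∀ I : Submodule Λᵐᵒᵖ Λ, Module.Projective Λᵐᵒᵖ I

/-- `π : P ⟶ S` is a projective cover: `P` is projective, `π` is surjective, and its kernel is
superfluous. -/
structure IsProjectiveCover {R : Type v} [Ring R] {P S : ModuleCat.{v} R} (π : P ⟶ S) : Prop where
  projective : Module.Projective R P
  surjective : Function.Surjective π.hom
  superfluous : ∀ N : Submodule R P, N ⊔ LinearMap.ker π.hom = ⊤ → N = ⊤

/-- The simple right `Λ`-modules `S 0, …, S (n - 1)` in a fixed order, one from each isomorphism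
class, together with their projective covers `π i : P i ⟶ S i`. Right `Λ`-modules are modules over
`Λᵐᵒᵖ`. -/
structure SimpleCovers (Λ : Type v) [Ring Λ] (n : ℕ) where
  S : Fin n → ModuleCat.{v} Λᵐᵒᵖ
  simple : ∀ i, IsSimpleModule Λᵐᵒᵖ (S i)
  eq_of_iso : ∀ i j, Nonempty (S i ≅ S j) → i = j
  exists_iso : ∀ M : ModuleCat.{v} Λᵐᵒᵖ, IsSimpleModule Λᵐᵒᵖ M → ∃ i, Nonempty (M ≅ S i)
  P : Fin n → ModuleCat.{v} Λᵐᵒᵖ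
  π : ∀ i, P i ⟶ S i
  cover : ∀ i, IsProjectiveCover (π i)

namespace SimpleCovers

variable {Λ : Type v} [Ring Λ] {n : ℕ} (D : SimpleCovers Λ n)

/-- `P(γ) = ⨁ i, (P i) ^ (γ i)`. -/
def proj (γ : Fin n → ℕ) : ModuleCat.{v} Λᵐᵒᵖ :=
  ModuleCat.of Λᵐᵒᵖ (∀ i, Fin (γ i) → D.P i)

theorem finite_P (i : Fin n) : Module.Finite Λᵐᵒᵖ (D.P i) := by
  have := D.simple i
  have := IsSimpleModule.nontrivial Λᵐᵒᵖ (D.S i)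
  obtain ⟨s, hs⟩ := exists_ne (0 : D.S i)
  obtain ⟨x, rfl⟩ := (D.cover i).surjective s
  refine ⟨⟨{x}, (D.cover i).superfluous _ ?_⟩⟩
  rw [eq_top_iff]
  rintro y -
  have hy : (D.π i).hom y ∈ Submodule.span Λᵐᵒᵖ {(D.π i).hom x} := by
    rw [IsSimpleModule.span_singleton_eq_top Λᵐᵒᵖ hs]
    trivial
  obtain ⟨r, hr⟩ := Submodule.mem_span_singleton.1 hy
  have h : y = r • x + (y - r • x) := by abel
  rw [h]
  refine Submodule.add_mem_sup (Submodule.smul_mem _ _ (Submodule.subset_span (by simp))) ?_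
  simp [LinearMap.mem_ker, hr]

theorem finite_proj (γ : Fin n → ℕ) : Module.Finite Λᵐᵒᵖ (D.proj γ) := by
  have := D.finite_P
  exact inferInstanceAs (Module.Finite Λᵐᵒᵖ (∀ i, Fin (γ i) → D.P i))

theorem projective_proj (γ : Fin n → ℕ) : Module.Projective Λᵐᵒᵖ (D.proj γ) := by
  have := fun i => (D.cover i).projective
  have h (i : Fin n) : Module.Projective Λᵐᵒᵖ (Fin (γ i) → D.P i) :=
    .of_equiv (DFinsupp.linearEquivFunOnFintype (R := Λᵐᵒᵖ) (M := fun _ : Fin (γ i) => D.P i))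
  exact .of_equiv (M := Π₀ i, Fin (γ i) → D.P i)
    (DFinsupp.linearEquivFunOnFintype (R := Λᵐᵒᵖ) (M := fun i => Fin (γ i) → D.P i))

/-- The dimension vector of a right module: the `i`-th coordinate is the dimension of
`Hom(P i, M)` over the division algebra `F i = End (P i)` (acting by precomposition). -/
noncomputable def dimVec (M : ModuleCat.{v} Λᵐᵒᵖ) (i : Fin n) : ℕ :=
  Module.finrank (End (D.P i))ᵐᵒᵖ (D.P i ⟶ M)

/-- The presentation space `Hom(P(γ₁), P(γ₀))`, a vector space over `K` whenever `Λ` is a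
`K`-algebra. -/
abbrev PresSpace (γ₁ γ₀ : Fin n → ℕ) : Type v := D.proj γ₁ ⟶ D.proj γ₀

end SimpleCovers

/-- Objects of the category of presentations: maps `X₁ ⟶ X₀` between finitely generated
projective right `Λ`-modules. -/
structure Pres (Λ : Type v) [Ring Λ] where
  X₁ : ModuleCat.{v} Λᵐᵒᵖ
  X₀ : ModuleCat.{v} Λᵐᵒᵖ
  finite₁ : Module.Finite Λᵐᵒᵖ X₁
  finite₀ : Module.Finite Λᵐᵒᵖ X₀
  projective₁ : Module.Projective Λᵐᵒᵖ X₁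
  projective₀ : Module.Projective Λᵐᵒᵖ X₀
  map : X₁ ⟶ X₀

namespace Pres

variable {Λ : Type v} [Ring Λ]

/-- A presentation as a complex, with `X₁` in homological degree `1` (cohomological degree `-1`)
and `X₀` in degree `0`. -/
noncomputable def complex (X : Pres Λ) : CochainComplex (ModuleCat.{v} Λᵐᵒᵖ) ℤ :=
  HomologicalComplex.double X.map (c := ComplexShape.up ℤ) (i₀ := -1) (i₁ := 0) (by simp)

/-- A presentation as an object of the homotopy category of complexes of right modules. -/
noncomputable def toHomotopyCategory (X : Pres Λ) :
    HomotopyCategory (ModuleCat.{v} Λᵐᵒᵖ) (ComplexShape.up ℤ) :=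
  (HomotopyCategory.quotient _ _).obj X.complex

/-- Morphisms of presentations are homotopy classes of chain maps of degree `0`. -/
noncomputable instance : Category (Pres Λ) :=
  inferInstanceAs (Category (InducedCategory _ (toHomotopyCategory (Λ := Λ))))

/-- `Ext¹` in the category of presentations: homotopy classes of chain maps `X ⟶ Y[1]`. -/
noncomputable abbrev Ext1 (X Y : Pres Λ) : Type v :=
  X.toHomotopyCategory ⟶ (shiftFunctor _ (1 : ℤ)).obj Y.toHomotopyCategory

end Pres

/-- The presentation `P(γ₁) ⟶ P(γ₀)` given by an element of the presentation space. -/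
def SimpleCovers.pres {Λ : Type v} [Ring Λ] {n : ℕ} (D : SimpleCovers Λ n)
    {γ₁ γ₀ : Fin n → ℕ} (p : D.PresSpace γ₁ γ₀) : Pres Λ where
  X₁ := D.proj γ₁
  X₀ := D.proj γ₀
  finite₁ := D.finite_proj γ₁
  finite₀ := D.finite_proj γ₀
  projective₁ := D.projective_proj γ₁
  projective₀ := D.projective_proj γ₀
  map := p

/-- The dimension vector of the presentation `p : P(γ₁) ⟶ P(γ₀)`. -/
noncomputable def SimpleCovers.presDimVec {Λ : Type v} [Ring Λ] {n : ℕ} (D : SimpleCovers Λ n)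
    {γ₁ γ₀ : Fin n → ℕ} (_p : D.PresSpace γ₁ γ₀) (i : Fin n) : ℤ :=
  (D.dimVec (D.proj γ₀) i : ℤ) - (D.dimVec (D.proj γ₁) i : ℤ)

/-- The polynomial functions on a vector space: the algebra of functions generated by the linear
functionals. -/
def polyFunctions (K : Type u) (V : Type v) [Field K] [AddCommGroup V] [Module K V] :
    Subalgebra K (V → K) :=
  Algebra.adjoin K (Set.range fun φ : Module.Dual K V => (φ : V → K))

/-- The Zariski topology on the set of `K`-points of a `K`-vector space, considered as an affine
space over `K`: the open sets are the unions of nonvanishing sets of polynomial functions. -/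
abbrev zariskiTopology (K : Type u) (V : Type v) [Field K] [AddCommGroup V] [Module K V] :
    TopologicalSpace V :=
  TopologicalSpace.generateFrom {U | ∃ f ∈ polyFunctions K V, U = {v | f v ≠ 0}}

/-! Vanishing of `Ext1` says that for `f` in the set every `g : P(γ₁) ⟶ P(γ₀)` is `a ≫ f - f ≫ b`:
the tangent map at `f` of the orbit under automorphisms of `P(γ₁)` and `P(γ₀)` is onto
(`exists_of_subsingleton_ext1`). As `K` need not be algebraically closed, openness of the orbit
comes from linear algebra rather than a dimension count. The map `(a, b) ↦ a ≫ h - f ≫ b` depends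
polynomially on `h`, is onto at `h = f`, and kills `(𝟙, 𝟙)` there. Cramer's rule extends `(𝟙, 𝟙)` to
a polynomial family of kernel vectors (`exists_polyMap_mem_ker`). Where both components are
invertible, a determinant condition that holds at `f`, they give an isomorphism `f ≅ h`
(`exists_polyFunction_of_rigid`). Density follows because nonempty open sets meet when `K` is
infinite. -/

/-! ### Polynomial maps and Cramer's rule. -/

section PolynomialMaps

variable {K : Type*} [Field K] {V W W₁ W₂ : Type*} [AddCommGroup V] [Module K V]
  [AddCommGroup W] [Module K W] [AddCommGroup W₁] [Module K W₁] [AddCommGroup W₂] [Module K W₂]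

/-- A map between vector spaces is polynomial if its composition with every linear functional is
a polynomial function. -/
def IsPolyMap (K : Type*) [Field K] {V W : Type*} [AddCommGroup V] [Module K V]
    [AddCommGroup W] [Module K W] (q : V → W) : Prop :=
  ∀ φ : Module.Dual K W, (fun v => φ (q v)) ∈ polyFunctions K V

theorem const_mem_polyFunctions (c : K) : (fun _ : V => c) ∈ polyFunctions K V :=
  (polyFunctions K V).algebraMap_mem c

namespace IsPolyMap

theorem const (w : W) : IsPolyMap K (fun _ : V => w) := fun φ => const_mem_polyFunctions (φ w)

theorem of_linear (L : V →ₗ[K] W) : IsPolyMap K L := fun φ =>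
  Algebra.subset_adjoin ⟨φ ∘ₗ L, rfl⟩

theorem sub {q r : V → W} (hq : IsPolyMap K q) (hr : IsPolyMap K r) :
    IsPolyMap K (fun v => q v - r v) := fun φ => by
  simp only [map_sub]
  exact (polyFunctions K V).sub_mem (hq φ) (hr φ)

theorem smul {c : V → K} {q : V → W} (hc : c ∈ polyFunctions K V) (hq : IsPolyMap K q) :
    IsPolyMap K (fun v => c v • q v) := fun φ => by
  simp only [map_smul, smul_eq_mul]
  exact (polyFunctions K V).mul_mem hc (hq φ)

theorem comp_linear {q : V → W} (hq : IsPolyMap K q) (L : W →ₗ[K] W₁) :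
    IsPolyMap K (fun v => L (q v)) := fun φ => hq (φ ∘ₗ L)

theorem sum {ι : Type*} (s : Finset ι) {q : ι → V → W} (hq : ∀ i ∈ s, IsPolyMap K (q i)) :
    IsPolyMap K (fun v => ∑ i ∈ s, q i v) := fun φ => by
  have := (polyFunctions K V).sum_mem (fun i hi => hq i hi φ)
  convert this using 1
  ext v
  simp

theorem bilinear [FiniteDimensional K W₁] {q : V → W₁} {r : V → W₂} (hq : IsPolyMap K q)
    (hr : IsPolyMap K r) (B : W₁ →ₗ[K] W₂ →ₗ[K] W) : IsPolyMap K (fun v => B (q v) (r v)) := by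
  let e := Module.finBasis K W₁
  have h : (fun v => B (q v) (r v)) = fun v => ∑ i, e.coord i (q v) • B (e i) (r v) := by
    ext v
    conv_lhs => rw [← e.sum_repr (q v)]
    simp only [map_sum, map_smul, LinearMap.sum_apply, LinearMap.smul_apply, e.coord_apply]
  rw [h]
  exact sum _ fun i _ => smul (hq _) (hr.comp_linear (B (e i)))

end IsPolyMap

theorem det_mem_polyFunctions {ι : Type*} [Fintype ι] [DecidableEq ι] {M : V → Matrix ι ι K}
    (hM : ∀ i j, (fun v => M v i j) ∈ polyFunctions K V) :
    (fun v => (M v).det) ∈ polyFunctions K V := by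
  have h : (fun v => (M v).det) =
      ∑ σ : Equiv.Perm ι, Equiv.Perm.sign σ • ∏ i, fun v => M v (σ i) i := by
    ext v
    simp [Matrix.det_apply, Finset.sum_apply, Finset.prod_apply]
  rw [h]
  refine Subalgebra.sum_mem _ fun σ _ => ?_
  rw [Units.smul_def]
  exact Subalgebra.zsmul_mem _ (Subalgebra.prod_mem _ fun i _ => hM _ _) _

theorem adjugate_mem_polyFunctions {ι : Type*} [Fintype ι] [DecidableEq ι] {M : V → Matrix ι ι K}
    (hM : ∀ i j, (fun v => M v i j) ∈ polyFunctions K V) (i j : ι) :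
    (fun v => (M v).adjugate i j) ∈ polyFunctions K V := by
  simp only [Matrix.adjugate_apply]
  refine det_mem_polyFunctions fun k l => ?_
  simp only [Matrix.updateRow_apply]
  split_ifs
  · exact const_mem_polyFunctions _
  · exact hM k l

namespace IsPolyMap

theorem toMatrix {ι : Type*} [Fintype ι] [DecidableEq ι] (e : Module.Basis ι K W)
    {q : V → Module.End K W} (hq : IsPolyMap K q) (i j : ι) :
    (fun v => LinearMap.toMatrix e e (q v) i j) ∈ polyFunctions K V := by
  simpa [LinearMap.toMatrix_apply] using hq (e.coord i ∘ₗ LinearMap.applyₗ (e j))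

theorem det [FiniteDimensional K W] {q : V → Module.End K W} (hq : IsPolyMap K q) :
    (fun v => LinearMap.det (q v)) ∈ polyFunctions K V := by
  let e := Module.finBasis K W
  simp only [← LinearMap.det_toMatrix e]
  exact det_mem_polyFunctions (hq.toMatrix e)

/-- The adjugate in a fixed basis serves as an inverse up to the determinant, with no denominators.
-/
theorem exists_adjugate [FiniteDimensional K W] {q : V → Module.End K W} (hq : IsPolyMap K q) :
    ∃ r : V → Module.End K W, IsPolyMap K r ∧
      ∀ v w, q v (r v w) = LinearMap.det (q v) • w := by
  let e := Module.finBasis K W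
  let M := fun v => LinearMap.toMatrix e e (q v)
  refine ⟨fun v => Matrix.toLin e e (M v).adjugate, fun φ => ?_, fun v w => ?_⟩
  · have h : (fun v => φ (Matrix.toLin e e (M v).adjugate)) = fun v =>
        ∑ i, ∑ j, (M v).adjugate i j • φ (Matrix.toLin e e (Matrix.single i j 1)) := by
      ext v
      conv_lhs => rw [Matrix.matrix_eq_sum_single (M v).adjugate]
      simp only [map_sum]
      refine Finset.sum_congr rfl fun i _ => Finset.sum_congr rfl fun j _ => ?_
      rw [← map_smul, ← map_smul, Matrix.smul_single, smul_eq_mul, mul_one]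
    have hadj := fun i j => adjugate_mem_polyFunctions (hq.toMatrix e) i j
    have hsum : IsPolyMap K fun v =>
        ∑ i, ∑ j, (M v).adjugate i j • φ (Matrix.toLin e e (Matrix.single i j 1)) :=
      .sum _ fun i _ => .sum _ fun j _ => .smul (hadj i j) (.const _)
    rw [h]
    exact hsum LinearMap.id
  · have h : q v = Matrix.toLin e e (M v) := (Matrix.toLin_toMatrix e e _).symm
    conv_lhs => rw [h]
    rw [← LinearMap.comp_apply, ← Matrix.toLin_mul, Matrix.mul_adjugate, map_smul,
      LinearMap.det_toMatrix]
    simp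

end IsPolyMap

/-! ### The Zariski topology and density of open sets. -/

theorem exists_polynomial_eval_of_mem_polyFunctions {f : V → K} (hf : f ∈ polyFunctions K V)
    (x y : V) : ∃ P : Polynomial K, ∀ t : K, f (x + t • y) = P.eval t := by
  induction hf using Algebra.adjoin_induction with
  | mem f hf =>
    obtain ⟨φ, rfl⟩ := hf
    exact ⟨.C (φ x) + .X * .C (φ y), fun t => by
      change φ (x + t • y) = _
      rw [map_add, map_smul, smul_eq_mul, Polynomial.eval_add, Polynomial.eval_mul]
      simp only [Polynomial.eval_C, Polynomial.eval_X]⟩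
  | algebraMap r => exact ⟨.C r, fun t => by simp⟩
  | add f g _ _ hf hg =>
    obtain ⟨P, hP⟩ := hf
    obtain ⟨Q, hQ⟩ := hg
    exact ⟨P + Q, fun t => by simp [hP, hQ]⟩
  | mul f g _ _ hf hg =>
    obtain ⟨P, hP⟩ := hf
    obtain ⟨Q, hQ⟩ := hg
    exact ⟨P * Q, fun t => by simp [hP, hQ]⟩

/-- On the line through `x` and `y` both functions become nonzero one-variable polynomials, and
their product has a non-root in the infinite field `K`. -/
theorem exists_ne_zero_of_mem_polyFunctions [Infinite K] {f g : V → K}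
    (hf : f ∈ polyFunctions K V) (hg : g ∈ polyFunctions K V) {x y : V} (hx : f x ≠ 0)
    (hy : g y ≠ 0) : ∃ z, f z ≠ 0 ∧ g z ≠ 0 := by
  obtain ⟨P, hP⟩ := exists_polynomial_eval_of_mem_polyFunctions hf x (y - x)
  obtain ⟨Q, hQ⟩ := exists_polynomial_eval_of_mem_polyFunctions hg x (y - x)
  have hP0 : P ≠ 0 := by
    rintro rfl
    exact hx (by simpa using hP 0)
  have hQ0 : Q ≠ 0 := by
    rintro rfl
    exact hy (by simpa using hQ 1)
  obtain ⟨t, ht⟩ : ∃ t, (P * Q).eval t ≠ 0 := by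
    by_contra! h
    exact mul_ne_zero hP0 hQ0 (Polynomial.funext (by simpa using h))
  rw [Polynomial.eval_mul] at ht
  exact ⟨x + t • (y - x), hP t ▸ left_ne_zero_of_mul ht, hQ t ▸ right_ne_zero_of_mul ht⟩

theorem isTopologicalBasis_zariskiTopology :
    @TopologicalSpace.IsTopologicalBasis V (zariskiTopology K V)
      {U | ∃ f ∈ polyFunctions K V, U = {v | f v ≠ 0}} := by
  let := zariskiTopology K V
  refine ⟨?_, ?_, rfl⟩
  · rintro _ ⟨f, hf, rfl⟩ _ ⟨g, hg, rfl⟩ x hx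
    refine ⟨_, ⟨f * g, mul_mem hf hg, rfl⟩, ?_, fun y hy => ?_⟩
    · exact mul_ne_zero hx.1 hx.2
    · exact ⟨left_ne_zero_of_mul hy, right_ne_zero_of_mul hy⟩
  · refine Set.eq_univ_of_forall fun x => ?_
    exact ⟨_, ⟨1, one_mem _, rfl⟩, one_ne_zero⟩

theorem isOpen_zariskiTopology_iff {S : Set V} :
    @IsOpen V (zariskiTopology K V) S ↔
      ∀ x ∈ S, ∃ f ∈ polyFunctions K V, f x ≠ 0 ∧ ∀ y, f y ≠ 0 → y ∈ S := by
  let := zariskiTopology K V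
  rw [(isTopologicalBasis_zariskiTopology (K := K) (V := V)).isOpen_iff]
  refine forall₂_congr fun x _ => ⟨?_, ?_⟩
  · rintro ⟨_, ⟨f, hf, rfl⟩, hx, hS⟩
    exact ⟨f, hf, hx, hS⟩
  · rintro ⟨f, hf, hx, hS⟩
    exact ⟨_, ⟨f, hf, rfl⟩, hx, hS⟩

theorem dense_zariskiTopology_of_isOpen [Infinite K] {S : Set V}
    (hS : @IsOpen V (zariskiTopology K V) S) (hne : S.Nonempty) : @Dense V (zariskiTopology K V) S := by
  let := zariskiTopology K V
  obtain ⟨x, hx⟩ := hne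
  obtain ⟨f, hf, hfx, hfS⟩ := isOpen_zariskiTopology_iff.1 hS x hx
  rw [(isTopologicalBasis_zariskiTopology (K := K) (V := V)).dense_iff]
  rintro _ ⟨g, hg, rfl⟩ ⟨y, hy⟩
  obtain ⟨z, hzf, hzg⟩ := exists_ne_zero_of_mem_polyFunctions hf hg hfx hy
  exact ⟨z, hzg, hfS z hzf⟩

/-- Let `Φ h` be linear maps `E → W` depending polynomially on `h`. If `Φ x` is surjective, then
every vector `e` in the kernel of `Φ x` is the value at `x` of a polynomial map `s` with
`s h ∈ ker (Φ h)` for all `h`. -/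
theorem exists_polyMap_mem_ker {E : Type*} [AddCommGroup E] [Module K E] [FiniteDimensional K E]
    [FiniteDimensional K W] {Φ : V → E →ₗ[K] W} (hΦ : IsPolyMap K Φ) {x : V}
    (hx : Function.Surjective (Φ x)) {e : E} (he : Φ x e = 0) :
    ∃ s : V → E, IsPolyMap K s ∧ s x = e ∧ ∀ h, Φ h (s h) = 0 := by
  obtain ⟨σ, hσ⟩ := (Φ x).exists_rightInverse_of_surjective (LinearMap.range_eq_top.2 hx)
  have hM : IsPolyMap K fun h => Φ h ∘ₗ σ := hΦ.comp_linear (LinearMap.lcomp K W σ)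
  obtain ⟨r, hr, hr'⟩ := hM.exists_adjugate
  -- With `r h` the adjugate of `Φ h ∘ₗ σ`, applying `Φ h` makes the two terms cancel. At `x` the
  -- determinant is `1`, since `σ` is a section, and the correction vanishes because `Φ x e = 0`.
  refine ⟨fun h => LinearMap.det (Φ h ∘ₗ σ) • e - σ (r h (Φ h e)), ?_, ?_, fun h => ?_⟩
  · exact (IsPolyMap.smul hM.det (.const e)).sub
      ((hr.bilinear (hΦ.comp_linear (LinearMap.applyₗ e)) LinearMap.id).comp_linear σ)
  · simp [hσ, he]
  · have := hr' h (Φ h e)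
    simp only [LinearMap.comp_apply] at this
    simp [this]

end PolynomialMaps

/-! ### Orbits of arrows in a linear category. -/

section Orbits

variable {K : Type*} [Field K] {C : Type*} [Category* C] [Preadditive C] [Linear K C]

/-- Turns invertibility of `a` into a polynomial condition: surjectivity of `a ≫ -` yields a right
inverse, and injectivity makes it two-sided. -/
theorem det_leftComp_ne_zero_iff {X : C} [FiniteDimensional K (X ⟶ X)] (a : X ⟶ X) :
    LinearMap.det (Linear.leftComp K X a) ≠ 0 ↔ IsIso a := by
  constructor
  · intro h
    have hbij : Function.Bijective (Linear.leftComp K X a) :=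
      (Module.End.isUnit_iff _).1 ((LinearMap.isUnit_iff_isUnit_det _).2 h.isUnit)
    obtain ⟨b, hb⟩ := hbij.2 (𝟙 X)
    have hb' : a ≫ b = 𝟙 X := hb
    exact ⟨b, hb', hbij.1 (by simp [reassoc_of% hb'])⟩
  · intro h
    have hinj : Function.Injective (Linear.leftComp K X a) := fun b c hbc =>
      (cancel_epi a).1 hbc
    exact ((LinearMap.isUnit_iff_isUnit_det _).1
      ((LinearMap.isUnit_iff_ker_eq_bot _).2 (LinearMap.ker_eq_bot.2 hinj))).ne_zero

/-- If every morphism `X ⟶ Y` is of the form `a ≫ f - f ≫ b`, then the arrows isomorphic to `f`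
contain a Zariski neighbourhood of `f`. -/
theorem exists_polyFunction_of_rigid {X Y : C} [FiniteDimensional K (X ⟶ Y)]
    [FiniteDimensional K (X ⟶ X)] [FiniteDimensional K (Y ⟶ Y)] (f : X ⟶ Y)
    (hf : ∀ g : X ⟶ Y, ∃ (a : X ⟶ X) (b : Y ⟶ Y), g = a ≫ f - f ≫ b) :
    ∃ d ∈ polyFunctions K (X ⟶ Y), d f ≠ 0 ∧
      ∀ h, d h ≠ 0 → ∃ (a : X ≅ X) (b : Y ≅ Y), a.hom ≫ h = f ≫ b.hom := by
  let Φ : (X ⟶ Y) → ((X ⟶ X) × (Y ⟶ Y)) →ₗ[K] (X ⟶ Y) := fun h =>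
    (Linear.comp (S := K) X X Y).flip h ∘ₗ LinearMap.fst K _ _ -
      Linear.leftComp K Y f ∘ₗ LinearMap.snd K _ _
  have hΦ (h a b) : Φ h (a, b) = a ≫ h - f ≫ b := rfl
  have hpoly : IsPolyMap K Φ := by
    have h := IsPolyMap.of_linear (LinearMap.lcomp K (X ⟶ Y) (LinearMap.fst K (X ⟶ X) (Y ⟶ Y)) ∘ₗ
      (Linear.comp (S := K) X X Y).flip)
    exact h.sub (.const _)
  obtain ⟨s, hs, hsf, hs'⟩ := exists_polyMap_mem_ker hpoly (x := f) (e := (𝟙 X, 𝟙 Y))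
    (fun g => by
      obtain ⟨a, b, h⟩ := hf g
      exact ⟨(a, b), h.symm⟩) (by simp [hΦ])
  refine ⟨fun h => LinearMap.det (Linear.leftComp K X (s h).1) *
    LinearMap.det (Linear.leftComp K Y (s h).2), ?_, ?_, fun h hh => ?_⟩
  · refine (polyFunctions K (X ⟶ Y)).mul_mem (x := fun h => LinearMap.det
      (Linear.leftComp K X (s h).1)) ?_ ?_
    · exact IsPolyMap.det (hs.comp_linear (Linear.comp (S := K) X X X ∘ₗ LinearMap.fst K _ _))
    · exact IsPolyMap.det (hs.comp_linear (Linear.comp (S := K) Y Y Y ∘ₗ LinearMap.snd K _ _))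
  · simp only [hsf]
    exact mul_ne_zero ((det_leftComp_ne_zero_iff _).2 inferInstance)
      ((det_leftComp_ne_zero_iff _).2 inferInstance)
  · have h₁ := (det_leftComp_ne_zero_iff _).1 (left_ne_zero_of_mul hh)
    have h₂ := (det_leftComp_ne_zero_iff _).1 (right_ne_zero_of_mul hh)
    exact ⟨asIso (s h).1, asIso (s h).2, sub_eq_zero.1 (hs' h)⟩

end Orbits

theorem ModuleCat.finiteDimensional_hom (K : Type u) [Field K] {R : Type v} [Ring R] [Algebra K R]
    [Module.Finite K R] (M N : ModuleCat.{v} R) [Module.Finite R M] [Module.Finite R N] :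
    FiniteDimensional K (M ⟶ N) := by
  let := ModuleCat.moduleOfAlgebraModule (k := K) M
  let := ModuleCat.moduleOfAlgebraModule (k := K) N
  have := ModuleCat.isScalarTower_of_algebra_moduleCat (k := K) M
  have := ModuleCat.isScalarTower_of_algebra_moduleCat (k := K) N
  have : Module.Finite K M := .trans R M
  have : Module.Finite K N := .trans R N
  let φ : (M ⟶ N) →ₗ[K] (M →ₗ[K] N) :=
    { toFun f := f.hom.restrictScalars K
      map_add' _ _ := rfl
      map_smul' _ _ := rfl }
  exact Module.Finite.of_injective φ fun f g h => by
    ext x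
    exact LinearMap.congr_fun h x

/-! ### Presentations, their isomorphisms and `Ext1`. -/

namespace Pres

variable {Λ : Type v} [Ring Λ] {X Y : Pres Λ}

/-- The component of `X.complex` in degree `-1`. -/
noncomputable def complexXIso₁ (X : Pres Λ) : X.complex.X (-1) ≅ X.X₁ :=
  HomologicalComplex.doubleXIso₀ X.map _

/-- The component of `X.complex` in degree `0`. -/
noncomputable def complexXIso₀ (X : Pres Λ) : X.complex.X 0 ≅ X.X₀ :=
  HomologicalComplex.doubleXIso₁ X.map _ (by decide)

theorem complex_d (X : Pres Λ) :
    X.complex.d (-1) 0 = X.complexXIso₁.hom ≫ X.map ≫ X.complexXIso₀.inv :=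
  HomologicalComplex.double_d _ _ _

theorem complex_d_eq_zero (X : Pres Λ) (i j : ℤ) (hi : i ≠ -1) : X.complex.d i j = 0 :=
  HomologicalComplex.double_d_eq_zero₀ _ _ _ _ hi

/-- The morphism from `X.complex` given by its components in degrees `-1` and `0`. -/
noncomputable def complexDesc {L : CochainComplex (ModuleCat.{v} Λᵐᵒᵖ) ℤ} (a : X.X₁ ⟶ L.X (-1))
    (b : X.X₀ ⟶ L.X 0) (h : a ≫ L.d (-1) 0 = X.map ≫ b) (hb : ∀ k, b ≫ L.d 0 k = 0) :
    X.complex ⟶ L :=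
  HomologicalComplex.mkHomFromDouble _ (by decide) a b h fun k _ => hb k

section

variable {L : CochainComplex (ModuleCat.{v} Λᵐᵒᵖ) ℤ} (a : X.X₁ ⟶ L.X (-1))
  (b : X.X₀ ⟶ L.X 0) (h : a ≫ L.d (-1) 0 = X.map ≫ b) (hb : ∀ k, b ≫ L.d 0 k = 0)

@[simp]
theorem complexDesc_f₁ : (complexDesc a b h hb).f (-1) = X.complexXIso₁.hom ≫ a :=
  HomologicalComplex.mkHomFromDouble_f₀ ..

@[simp]
theorem complexDesc_f₀ : (complexDesc a b h hb).f 0 = X.complexXIso₀.hom ≫ b :=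
  HomologicalComplex.mkHomFromDouble_f₁ ..

end

/-- The morphism of complexes given by a commutative square. -/
noncomputable def complexMap (a : X.X₁ ⟶ Y.X₁) (b : X.X₀ ⟶ Y.X₀) (h : a ≫ Y.map = X.map ≫ b) :
    X.complex ⟶ Y.complex :=
  complexDesc (a ≫ Y.complexXIso₁.inv) (b ≫ Y.complexXIso₀.inv)
    (by simp [complex_d, reassoc_of% h]) (fun k => by simp [complex_d_eq_zero])

theorem complexMap_comp_eq_id (a : X.X₁ ≅ Y.X₁) (b : X.X₀ ≅ Y.X₀)
    (h : a.hom ≫ Y.map = X.map ≫ b.hom) (h' : a.inv ≫ X.map = Y.map ≫ b.inv) :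
    complexMap a.hom b.hom h ≫ complexMap a.inv b.inv h' = 𝟙 _ := by
  apply HomologicalComplex.from_double_hom_ext <;>
    (simp [complexMap]; rfl)

/-- Isomorphic arrows are isomorphic as presentations. -/
theorem nonempty_iso_of_arrow_iso (a : X.X₁ ≅ Y.X₁) (b : X.X₀ ≅ Y.X₀)
    (h : a.hom ≫ Y.map = X.map ≫ b.hom) : Nonempty (X ≅ Y) := by
  have h' : a.inv ≫ X.map = Y.map ≫ b.inv := by
    rw [Iso.inv_comp_eq, ← Category.assoc, Iso.eq_comp_inv, h]
  let e : X.complex ≅ Y.complex :=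
    { hom := complexMap a.hom b.hom h
      inv := complexMap a.inv b.inv h'
      hom_inv_id := complexMap_comp_eq_id a b h h'
      inv_hom_id := complexMap_comp_eq_id a.symm b.symm h' h }
  exact ⟨InducedCategory.isoMk ((HomotopyCategory.quotient _ _).mapIso e)⟩

/-- Carries rigidity from one point of the orbit to all others, so the neighbourhood argument
applies at each of them. -/
theorem subsingleton_ext1_of_iso (e : X ≅ Y) (hX : Subsingleton (Ext1 X X)) :
    Subsingleton (Ext1 Y Y) := by
  let e' : X.toHomotopyCategory ≅ Y.toHomotopyCategory :=
    (inducedFunctor (toHomotopyCategory (Λ := Λ))).mapIso e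
  exact (e'.homCongr ((shiftFunctor _ (1 : ℤ)).mapIso e')).subsingleton_congr.1 hX

/-- If `Ext¹(X, Y)` vanishes, then every morphism `X₁ ⟶ Y₀` is null-homotopic. -/
theorem exists_of_subsingleton_ext1 (h : Subsingleton (Ext1 X Y)) (g : X.X₁ ⟶ Y.X₀) :
    ∃ (a : X.X₁ ⟶ Y.X₁) (b : X.X₀ ⟶ Y.X₀), g = a ≫ Y.map - X.map ≫ b := by
  -- Degree `-1` of `Y[1]` is `Y₀`, whose outgoing differential is zero, so any `g` is a chain map.
  let φ : X.complex ⟶ (shiftFunctor _ (1 : ℤ)).obj Y.complex :=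
    complexDesc (g ≫ Y.complexXIso₀.inv) 0
      (by
        rw [CochainComplex.shiftFunctor_obj_d', complex_d_eq_zero _ _ _ (by decide), smul_zero]
        exact Limits.comp_zero.trans Limits.comp_zero.symm)
      (fun k => Limits.zero_comp)
  have hφ : (HomotopyCategory.quotient _ _).map φ = (HomotopyCategory.quotient _ _).map 0 := by
    -- `Ext1` shifts in the homotopy category, while `φ` lands in a shifted complex; `commShiftIso`
    -- identifies the two.
    rw [← cancel_mono (((HomotopyCategory.quotient (ModuleCat.{v} Λᵐᵒᵖ)
      (ComplexShape.up ℤ)).commShiftIso (1 : ℤ)).app Y.complex).hom]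
    exact h.elim _ _
  have hc := (HomotopyCategory.homotopyOfEq _ _ hφ).comm (-1)
  set s := (HomotopyCategory.homotopyOfEq _ _ hφ).hom
  have hφ' : φ.f (-1) = X.complexXIso₁.hom ≫ g ≫ Y.complexXIso₀.inv := complexDesc_f₁ ..
  have hd : ((shiftFunctor (CochainComplex (ModuleCat.{v} Λᵐᵒᵖ) ℤ) (1 : ℤ)).obj Y.complex).d
      (-2) (-1) = -(Y.complexXIso₁.hom ≫ Y.map ≫ Y.complexXIso₀.inv) := by
    rw [CochainComplex.shiftFunctor_obj_d', ← complex_d]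
    simp
  rw [dNext_eq s (i := -1) (i' := 0) (by simp), prevD_eq s (j := -1) (j' := -2) (by simp),
    hφ', complex_d, hd, HomologicalComplex.zero_f, add_zero] at hc
  let s₁ : X.complex.X (-1) ⟶ Y.complex.X (-1) := by exact s (-1) (-2)
  let s₀ : X.complex.X 0 ⟶ Y.complex.X 0 := by exact s 0 (-1)
  have hc' : X.complexXIso₁.hom ≫ g ≫ Y.complexXIso₀.inv =
      (X.complexXIso₁.hom ≫ X.map ≫ X.complexXIso₀.inv) ≫ s₀ +
        s₁ ≫ (-(Y.complexXIso₁.hom ≫ Y.map ≫ Y.complexXIso₀.inv)) := hc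
  -- The shift negates the differential, so `hc'` reads `g = X.map ≫ s₀ - s₁ ≫ Y.map` up to the
  -- identifications; hence both signs flip.
  refine ⟨-(X.complexXIso₁.inv ≫ s₁ ≫ Y.complexXIso₁.hom),
    -(X.complexXIso₀.inv ≫ s₀ ≫ Y.complexXIso₀.hom), ?_⟩
  have := congrArg (fun t => X.complexXIso₁.inv ≫ t ≫ Y.complexXIso₀.hom) hc'
  simp only [Preadditive.comp_add, Preadditive.add_comp, Preadditive.comp_neg,
    Preadditive.neg_comp, Category.assoc, Iso.inv_hom_id_assoc, Iso.inv_hom_id,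
    Category.comp_id] at this
  rw [this]
  simp only [Preadditive.comp_neg, Preadditive.neg_comp, Category.assoc]
  abel

end Pres

theorem theorem2p3p9 (K : Type u) [Field K] [Infinite K]
    (Λ : Type v) [Ring Λ] [Algebra K Λ] [Module.Finite K Λ] (hΛ : IsHereditary Λ)
    (n : ℕ) (D : SimpleCovers Λ n) (γ₁ γ₀ : Fin n → ℕ) (p : D.PresSpace γ₁ γ₀)
    (α : Fin n → ℤ) (hα : D.presDimVec p = α)
    (hp : Subsingleton (Pres.Ext1 (D.pres p) (D.pres p))) :
    @IsOpen _ (zariskiTopology K (D.PresSpace γ₁ γ₀))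
      {f : D.PresSpace γ₁ γ₀ | Nonempty (D.pres f ≅ D.pres p)} ∧
    @Dense _ (zariskiTopology K (D.PresSpace γ₁ γ₀))
      {f : D.PresSpace γ₁ γ₀ | Nonempty (D.pres f ≅ D.pres p)} := by
  have : Module.Finite K Λᵐᵒᵖ := .equiv (MulOpposite.opLinearEquiv K)
  have := D.finite_proj γ₁
  have := D.finite_proj γ₀
  have := ModuleCat.finiteDimensional_hom K (D.proj γ₁) (D.proj γ₁)
  have := ModuleCat.finiteDimensional_hom K (D.proj γ₁) (D.proj γ₀)
  have := ModuleCat.finiteDimensional_hom K (D.proj γ₀) (D.proj γ₀)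
  have hopen : @IsOpen _ (zariskiTopology K (D.PresSpace γ₁ γ₀))
      {f : D.PresSpace γ₁ γ₀ | Nonempty (D.pres f ≅ D.pres p)} := by
    refine isOpen_zariskiTopology_iff.2 ?_
    rintro f ⟨e⟩
    obtain ⟨d, hd, hdf, h⟩ := exists_polyFunction_of_rigid (K := K) f
      (Pres.exists_of_subsingleton_ext1 (Pres.subsingleton_ext1_of_iso e.symm hp))
    refine ⟨d, hd, hdf, fun g hg => ?_⟩
    obtain ⟨a, b, hab⟩ := h g hg
    obtain ⟨e'⟩ := Pres.nonempty_iso_of_arrow_iso (X := D.pres f) (Y := D.pres g) a b hab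
    exact ⟨e'.symm ≪≫ e⟩
  exact ⟨hopen, dense_zariskiTopology_of_isOpen hopen ⟨p, ⟨Iso.refl _⟩⟩⟩
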